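/- All rings are commutative Noetherian with identity. Let $R$ be a ring. * $R$ satisfies (SAC) (the symmetric Auslander condition) if for every finitely generated $R$-module $M$ the following holds: if $\operatorname{Ext}_R^i(M,R)=0$ for all $i>0$ and $\operatorname{Ext}_R^i(M,M)=0$ for all sufficiently large $i$, then $\operatorname{Ext}_R^i(M,M)=0$ for all $i>0$. * For a finitely generated $R$-module $M$, the self-extension degree is $\operatorname{ext.deg}(M)=\sup\{i\mid \operatorname{Ext}_R^i(M,M)\neq 0\}$ (which is $\infty$ if this set is unbounded). * The restricted finitistic extension degree of $R$ is $$\operatorname{rfed}(R)=\sup\{\operatorname{ext.deg}(M\oplus R)\mid M \text{ a finitely generated } R\text{-module with } \operatorname{ext.deg}(M\oplus R)<\infty\}.$$ * For an integer $n\ge 0$, $$\operatorname{rfed}_n(R)=\sup\{\operatorname{ext.deg}(M\oplus R)\mid M \text{ a finitely generated } R\text{-module of constant rank } n \text{ with } \operatorname{ext.deg}(M\oplus R)<\infty\},$$ where $M$ has constant rank $n$ if $M\otimes_R Q$ is a free $Q$-module of rank $n$, with $Q$ the total ring of fractions of $R$. **Theorem.** Let $R$ be a local ring of positive depth (that is,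 the maximal ideal contains a non-zerodivisor of $R$). Then the following are equivalent: 1. $R$ satisfies (SAC); 2. $\operatorname{rfed}(R)<\infty$; 3. there is an integer $n\ge 0$ such that $\operatorname{rfed}_n(R)<\infty$. -/

import Mathlib

universe u

open CategoryTheory

namespace Rfed

noncomputable section

section

variable (R : Type u) [CommRing R]

/-- The vanishing of `Ext_R^i(M, N)`. -/
def ExtVanishes (M N : Type u) [AddCommGroup M] [Module R M] [AddCommGroup N] [Module R N]
    (i : ℕ) : Prop :=
  Subsingleton (Abelian.Ext (ModuleCat.of R M) (ModuleCat.of R N) i)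

/-- The symmetric Auslander condition: for each finitely generated `R`-module `M`, if
`Ext^i(M, R) = 0` for all `i > 0` and `Ext^i(M, M) = 0` for all large `i`, then
`Ext^i(M, M) = 0` for all `i > 0`. -/
def SAC : Prop :=
  ∀ (M : Type u) [AddCommGroup M] [Module R M] [Module.Finite R M],
    (∀ i : ℕ, 0 < i → ExtVanishes R M R i) →
    (∃ k : ℕ, ∀ i : ℕ, k < i → ExtVanishes R M M i) →
    ∀ i : ℕ, 0 < i → ExtVanishes R M M i

/-- The self-extension degree `sup {i | Ext^i(M, M) ≠ 0}`, with value `⊤` if the set is unbounded.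
It is only used for the nonzero modules `M ⊕ R`, where the set contains `0` (unless `R = 0`). -/
def extDeg (M : Type u) [AddCommGroup M] [Module R M] : ℕ∞ :=
  ⨆ (i : ℕ) (_ : ¬ ExtVanishes R M M i), (i : ℕ∞)

/-- `M` has constant rank `n`: with `Q` the total ring of fractions of `R` (the localization at
all non-zerodivisors), `Q ⊗ M` is a free `Q`-module of rank `n`. -/
def HasConstantRank (M : Type u) [AddCommGroup M] [Module R M] (n : ℕ) : Prop :=
  Nonempty (TensorProduct R (FractionRing R) M ≃ₗ[FractionRing R] (Fin n → FractionRing R))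

/-- The restricted finitistic extension degree: the supremum of the finite values of
`extDeg (M ⊕ R)`, where `M` runs through the finitely generated `R`-modules. -/
def rfed : ℕ∞ :=
  sSup {d : ℕ∞ | ∃ M : ModuleCat.{u} R, Module.Finite R M ∧ extDeg R (M × R) = d ∧ d < ⊤}

/-- The variant of `rfed` where `M` runs through the finitely generated `R`-modules of constant
rank `n` only. -/
def rfedRank (n : ℕ) : ℕ∞ :=
  sSup {d : ℕ∞ | ∃ M : ModuleCat.{u} R, Module.Finite R M ∧ HasConstantRank R M n ∧
    extDeg R (M × R) = d ∧ d < ⊤}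

/-- The depth of a local ring: the supremum of the lengths of the `R`-regular sequences in the
maximal ideal. -/
def depth [IsLocalRing R] : ℕ∞ :=
  sSup {d : ℕ∞ | ∃ rs : List R, (∀ r ∈ rs, r ∈ IsLocalRing.maximalIdeal R) ∧
    RingTheory.Sequence.IsRegular R rs ∧ (rs.length : ℕ∞) = d}

end

end

end Rfed

/-! SAC gives a finite bound as follows. If `Ext^i(N, R) = 0` for `i > 0` and `Ext^i(N, N) = 0` for
large `i`, then SAC applied to the sum of `N` and its syzygy `L` gives `Ext^1(N, L) = 0`, so `N` is
projective (`SAC.projective`). By passing to syzygies, every `M` with `ext.deg(M ⊕ R)` finite has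
finite projective dimension. This dimension is at most the least `t` with `Ext^t(k, R) ≠ 0`
(`exists_finitistic_bound`), so `t` bounds `rfed`, and hence every `rfed_n`.

Conversely, let `x` in the maximal ideal be regular. A module killed by `x` acquires constant rank
`n` on adding `R^n`, so a bound `b` on `rfed_n` controls the self-extensions of `M/xM ⊕ N/xN`.
Nakayama lifts this to `Ext^i(M, N) = 0` for `i ≥ b`, where `b` does not depend on `M` and `N`
(`exists_bound_ext_of_rfedRank_lt_top`). Replacing the second argument by a `b`-th syzygy shifts
degrees by `b`, so this bound forces vanishing in all positive degrees. -/

namespace Rfed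

open Abelian

/-! ### Vanishing in long exact sequences. -/

section LongExactSequence

variable {R : Type u} [CommRing R] {S : ShortComplex (ModuleCat.{u} R)} (hS : S.ShortExact)
  (X : ModuleCat.{u} R)

include hS in
theorem ext_covariant_vanish₁ {i j : ℕ} (hij : i + 1 = j) (h₃ : Subsingleton (Ext X S.X₃ i))
    (h₂ : Subsingleton (Ext X S.X₂ j)) : Subsingleton (Ext X S.X₁ j) := by
  refine subsingleton_of_forall_eq 0 fun e => ?_
  obtain ⟨y, rfl⟩ := Ext.covariant_sequence_exact₁ X hS e (Subsingleton.elim _ _) hij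
  rw [Subsingleton.elim y 0, Ext.zero_comp]

include hS in
theorem ext_covariant_vanish₃ {i j : ℕ} (hij : i + 1 = j) (h₂ : Subsingleton (Ext X S.X₂ i))
    (h₁ : Subsingleton (Ext X S.X₁ j)) : Subsingleton (Ext X S.X₃ i) := by
  refine subsingleton_of_forall_eq 0 fun e => ?_
  obtain ⟨y, rfl⟩ := Ext.covariant_sequence_exact₃ X hS e hij (Subsingleton.elim _ _)
  rw [Subsingleton.elim y 0, Ext.zero_comp]

include hS in
theorem ext_contravariant_vanish₁ {i j : ℕ} (hij : i + 1 = j) (h₂ : Subsingleton (Ext S.X₂ X i))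
    (h₃ : Subsingleton (Ext S.X₃ X j)) : Subsingleton (Ext S.X₁ X i) := by
  refine subsingleton_of_forall_eq 0 fun e => ?_
  obtain ⟨y, rfl⟩ := Ext.contravariant_sequence_exact₁ hS X e (n₁ := j) (by lia)
    (Subsingleton.elim _ _)
  rw [Subsingleton.elim y 0, Ext.comp_zero]

include hS in
theorem ext_contravariant_vanish₃ {i j : ℕ} (hij : i + 1 = j) (h₁ : Subsingleton (Ext S.X₁ X i))
    (h₂ : Subsingleton (Ext S.X₂ X j)) : Subsingleton (Ext S.X₃ X j) := by
  refine subsingleton_of_forall_eq 0 fun e => ?_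
  obtain ⟨y, rfl⟩ := Ext.contravariant_sequence_exact₃ hS X e (Subsingleton.elim _ _)
    (n₀ := i) (by lia)
  rw [Subsingleton.elim y 0, Ext.comp_zero]

end LongExactSequence

/-! ### Ext and finite direct sums. -/

section FiniteSums

variable {R : Type u} [CommRing R]

/-- If the identity of `Y` is a sum of maps `Y ⟶ Z k ⟶ Y`, then `Ext X Y i` vanishes as soon as
all `Ext X (Z k) i` do. -/
theorem ext_vanish_of_id_eq_sum_right {ι : Type*} [Fintype ι] (X : ModuleCat.{u} R)
    {Y : ModuleCat.{u} R} {Z : ι → ModuleCat.{u} R} (p : ∀ k, Y ⟶ Z k) (q : ∀ k, Z k ⟶ Y)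
    (h : 𝟙 Y = ∑ k, p k ≫ q k) {i : ℕ} (hZ : ∀ k, Subsingleton (Ext X (Z k) i)) :
    Subsingleton (Ext X Y i) := by
  refine subsingleton_of_forall_eq 0 fun e => ?_
  rw [← Ext.comp_mk₀_id e, h, Ext.mk₀_sum, Ext.comp_sum]
  refine Finset.sum_eq_zero fun k _ => ?_
  rw [← Ext.mk₀_comp_mk₀, ← Ext.comp_assoc (a₁₂ := i) (a₂₃ := 0) _ _ _ (by lia) (by lia) (by lia),
    (hZ k).elim (e.comp (Ext.mk₀ (p k)) (add_zero i)) 0, Ext.zero_comp]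

theorem ext_vanish_of_id_eq_sum_left {ι : Type*} [Fintype ι] (X : ModuleCat.{u} R)
    {Y : ModuleCat.{u} R} {Z : ι → ModuleCat.{u} R} (p : ∀ k, Y ⟶ Z k) (q : ∀ k, Z k ⟶ Y)
    (h : 𝟙 Y = ∑ k, p k ≫ q k) {i : ℕ} (hZ : ∀ k, Subsingleton (Ext (Z k) X i)) :
    Subsingleton (Ext Y X i) := by
  refine subsingleton_of_forall_eq 0 fun e => ?_
  rw [← Ext.mk₀_id_comp e, h, Ext.mk₀_sum, Ext.sum_comp]
  refine Finset.sum_eq_zero fun k _ => ?_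
  rw [← Ext.mk₀_comp_mk₀, Ext.comp_assoc (a₁₂ := 0) (a₂₃ := i) _ _ _ (by lia) (by lia) (by lia),
    (hZ k).elim ((Ext.mk₀ (q k)).comp e (zero_add i)) 0, Ext.comp_zero]

theorem id_eq_sum_of_free (F : ModuleCat.{u} R) [Module.Free R F] [Module.Finite R F] :
    ∃ (ι : Type u) (_ : Fintype ι) (p : ι → (F ⟶ ModuleCat.of R R))
      (q : ι → (ModuleCat.of R R ⟶ F)), 𝟙 F = ∑ k, p k ≫ q k := by
  let b := Module.Free.chooseBasis R F
  refine ⟨_, inferInstance, fun k => ModuleCat.ofHom (b.coord k),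
    fun k => ModuleCat.ofHom (LinearMap.toSpanSingleton R F (b k)), ?_⟩
  ext v
  simp [ModuleCat.hom_sum, LinearMap.sum_apply, b.sum_repr]

theorem ext_free_vanish (X F : ModuleCat.{u} R) [Module.Free R F] [Module.Finite R F] {i : ℕ}
    (h : Subsingleton (Ext X (ModuleCat.of R R) i)) : Subsingleton (Ext X F i) := by
  obtain ⟨_, _, p, q, hpq⟩ := id_eq_sum_of_free F
  exact ext_vanish_of_id_eq_sum_right X p q hpq fun _ => h

theorem ext_prod_right_iff (X : ModuleCat.{u} R) (M N : Type u) [AddCommGroup M] [Module R M]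
    [AddCommGroup N] [Module R N] (i : ℕ) :
    Subsingleton (Ext X (ModuleCat.of R (M × N)) i) ↔
      Subsingleton (Ext X (ModuleCat.of R M) i) ∧ Subsingleton (Ext X (ModuleCat.of R N) i) := by
  refine ⟨fun h => ⟨?_, ?_⟩, fun ⟨h₁, h₂⟩ => ?_⟩
  · refine ext_vanish_of_id_eq_sum_right X (ι := Unit) (Z := fun _ => ModuleCat.of R (M × N))
      (fun _ => ModuleCat.ofHom (LinearMap.inl R M N))
      (fun _ => ModuleCat.ofHom (LinearMap.fst R M N)) ?_ fun _ => h
    ext; simp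
  · refine ext_vanish_of_id_eq_sum_right X (ι := Unit) (Z := fun _ => ModuleCat.of R (M × N))
      (fun _ => ModuleCat.ofHom (LinearMap.inr R M N))
      (fun _ => ModuleCat.ofHom (LinearMap.snd R M N)) ?_ fun _ => h
    ext; simp
  · refine ext_vanish_of_id_eq_sum_right X (ι := Bool)
      (Z := fun k => k.rec (ModuleCat.of R M) (ModuleCat.of R N))
      (fun k => k.rec (ModuleCat.ofHom (LinearMap.fst R M N))
        (ModuleCat.ofHom (LinearMap.snd R M N)))
      (fun k => k.rec (ModuleCat.ofHom (LinearMap.inl R M N))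
        (ModuleCat.ofHom (LinearMap.inr R M N))) ?_ (by rintro (_ | _) <;> assumption)
    rw [Fintype.sum_bool]
    ext v <;> simp

theorem ext_prod_left_iff (X : ModuleCat.{u} R) (M N : Type u) [AddCommGroup M] [Module R M]
    [AddCommGroup N] [Module R N] (i : ℕ) :
    Subsingleton (Ext (ModuleCat.of R (M × N)) X i) ↔
      Subsingleton (Ext (ModuleCat.of R M) X i) ∧ Subsingleton (Ext (ModuleCat.of R N) X i) := by
  refine ⟨fun h => ⟨?_, ?_⟩, fun ⟨h₁, h₂⟩ => ?_⟩
  · refine ext_vanish_of_id_eq_sum_left X (ι := Unit) (Z := fun _ => ModuleCat.of R (M × N))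
      (fun _ => ModuleCat.ofHom (LinearMap.inl R M N))
      (fun _ => ModuleCat.ofHom (LinearMap.fst R M N)) ?_ fun _ => h
    ext; simp
  · refine ext_vanish_of_id_eq_sum_left X (ι := Unit) (Z := fun _ => ModuleCat.of R (M × N))
      (fun _ => ModuleCat.ofHom (LinearMap.inr R M N))
      (fun _ => ModuleCat.ofHom (LinearMap.snd R M N)) ?_ fun _ => h
    ext; simp
  · refine ext_vanish_of_id_eq_sum_left X (ι := Bool)
      (Z := fun k => k.rec (ModuleCat.of R M) (ModuleCat.of R N))
      (fun k => k.rec (ModuleCat.ofHom (LinearMap.fst R M N))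
        (ModuleCat.ofHom (LinearMap.snd R M N)))
      (fun k => k.rec (ModuleCat.ofHom (LinearMap.inl R M N))
        (ModuleCat.ofHom (LinearMap.inr R M N))) ?_ (by rintro (_ | _) <;> assumption)
    rw [Fintype.sum_bool]
    ext v <;> simp

end FiniteSums

/-! ### Syzygies and dimension shifting. -/

section Syzygy

variable {R : Type u} [CommRing R]

/-- `N` is a first syzygy of `M`: the kernel of a surjection onto `M` from a finite free module. -/
def IsSyzygy (N M : ModuleCat.{u} R) : Prop :=
  ∃ S : ShortComplex (ModuleCat.{u} R), S.ShortExact ∧ S.X₁ = N ∧ S.X₃ = M ∧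
    Module.Free R S.X₂ ∧ Module.Finite R S.X₂

theorem exists_isSyzygy [IsNoetherianRing R] (M : ModuleCat.{u} R) [Module.Finite R M] :
    ∃ N : ModuleCat.{u} R, Module.Finite R N ∧ IsSyzygy N M := by
  obtain ⟨F, _, _, _, _, f, hf⟩ := Module.exists_finite_presentation R M
  exact ⟨_, inferInstanceAs (Module.Finite R (LinearMap.ker f)), f.shortComplexKer,
    LinearMap.shortExact_shortComplexKer hf, rfl, rfl, ‹_›, ‹_›⟩

namespace IsSyzygy

variable {N M : ModuleCat.{u} R} (h : IsSyzygy N M)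

include h

theorem ext_left_iff (X : ModuleCat.{u} R) {i j : ℕ} (hi : 0 < i) (hij : i + 1 = j) :
    Subsingleton (Ext N X i) ↔ Subsingleton (Ext M X j) := by
  obtain ⟨S, hS, rfl, rfl, _, _⟩ := h
  have aux (k : ℕ) (hk : 0 < k) : Subsingleton (Ext S.X₂ X k) := by
    obtain ⟨k, rfl⟩ := Nat.exists_eq_succ_of_ne_zero hk.ne'
    exact Ext.subsingleton_of_projective _ _ _
  exact ⟨fun h => ext_contravariant_vanish₃ hS X hij h (aux _ (by lia)),
    fun h => ext_contravariant_vanish₁ hS X hij (aux _ hi) h⟩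

theorem ext_right (X : ModuleCat.{u} R) {i j : ℕ} (hij : i + 1 = j)
    (hX : Subsingleton (Ext X (ModuleCat.of R R) j)) (hM : Subsingleton (Ext X M i)) :
    Subsingleton (Ext X N j) := by
  obtain ⟨S, hS, rfl, rfl, _, _⟩ := h
  exact ext_covariant_vanish₁ hS X hij hM (ext_free_vanish X _ hX)

theorem ext_of_ext_right (X : ModuleCat.{u} R) {i j : ℕ} (hij : i + 1 = j)
    (hX : Subsingleton (Ext X (ModuleCat.of R R) i)) (hN : Subsingleton (Ext X N j)) :
    Subsingleton (Ext X M i) := by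
  obtain ⟨S, hS, rfl, rfl, _, _⟩ := h
  exact ext_covariant_vanish₃ hS X hij (ext_free_vanish X _ hX) hN

/-- The obstruction to lifting the identity of `M` to the free cover lies in `Ext^1(M, N)`. -/
theorem projective_of_ext_one (h₁ : Subsingleton (Ext M N 1)) : Projective M := by
  obtain ⟨S, hS, rfl, rfl, _, _⟩ := h
  obtain ⟨f', hf'⟩ := Ext.covariant_sequence_exact₃ S.X₃ hS (Ext.mk₀ (𝟙 _)) (zero_add 1)
    (Subsingleton.elim _ _)
  obtain ⟨f, rfl⟩ := (Ext.mk₀_bijective _ _).2 f'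
  rw [Ext.mk₀_comp_mk₀, (Ext.mk₀_bijective _ _).1.eq_iff] at hf'
  exact (Retract.mk f S.g hf').projective

theorem hasProjectiveDimensionLE_succ_iff (n : ℕ) :
    HasProjectiveDimensionLE M (n + 1) ↔ HasProjectiveDimensionLE N n := by
  obtain ⟨S, hS, rfl, rfl, _, _⟩ := h
  exact hS.hasProjectiveDimensionLT_X₃_iff n inferInstance

/-- A syzygy embeds in a free module. Passing to it makes `x` regular even when `x` is a zero
divisor on `M`. -/
theorem isSMulRegular {x : R} (hx : IsSMulRegular R x) : IsSMulRegular N x := by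
  obtain ⟨S, hS, rfl, rfl, _, _⟩ := h
  have hF : IsSMulRegular S.X₂ x :=
    (Module.Free.chooseBasis R S.X₂).repr.isSMulRegular_congr x |>.2
      (hx.finsupp)
  exact hF.of_injective S.f.hom ((ModuleCat.mono_iff_injective _).1 hS.mono_f)

end IsSyzygy

end Syzygy

/-! ### Reduction modulo a regular element. -/

section RegularElement

variable {R : Type u} [CommRing R]

/-- Nakayama's lemma, since `Ext^i(M, N)` is finitely generated. -/
theorem ext_vanish_of_smul_surjective [IsLocalRing R] [IsNoetherianRing R]
    {M N : ModuleCat.{u} R} [Module.Finite R M]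
    [Module.Finite R N] {x : R} (hx : x ∈ IsLocalRing.maximalIdeal R) {i : ℕ}
    (h : ∀ e : Ext M N i, ∃ e' : Ext M N i, x • e' = e) : Subsingleton (Ext M N i) := by
  have key : (⊤ : Submodule R (Ext M N i)) ≤ ⊥ := by
    refine Submodule.le_of_le_smul_of_le_jacobson_bot (I := Ideal.span {x}) Module.Finite.fg_top
      ?_ ?_
    · rw [IsLocalRing.jacobson_eq_maximalIdeal _ bot_ne_top]
      simpa [Ideal.span_le] using hx
    · intro e _
      obtain ⟨e', rfl⟩ := h e
      exact Submodule.mem_sup_right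
        (Submodule.smul_mem_smul (Ideal.mem_span_singleton_self x) trivial)
  exact (Submodule.subsingleton_iff R).1 (subsingleton_of_bot_eq_top (le_bot_iff.1 key).symm)

/-- If `x` is regular on `N` and `Ext^i(M, N/xN) = 0`, then `Ext^i(M, N) = 0` by Nakayama. -/
theorem ext_vanish_of_ext_quotSMulTop_right [IsLocalRing R] [IsNoetherianRing R]
    {M N : ModuleCat.{u} R} [Module.Finite R M]
    [Module.Finite R N] {x : R} (hx : x ∈ IsLocalRing.maximalIdeal R) (hN : IsSMulRegular N x)
    {i : ℕ} (h : Subsingleton (Ext M (ModuleCat.of R (QuotSMulTop x N)) i)) :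
    Subsingleton (Ext M N i) := by
  refine ext_vanish_of_smul_surjective hx fun e => ?_
  obtain ⟨e', he'⟩ := Ext.covariant_sequence_exact₂ M hN.smulShortComplex_shortExact e
    (h.elim _ _)
  exact ⟨e', (Ext.smul_eq_comp_mk₀ (X := M) (Y := N) e' x).trans he'⟩

/-- If `x` is regular on `M`, kills `N`, and `Ext^{i+1}(M/xM, N) = 0`, then `Ext^i(M, N) = 0`. -/
theorem ext_vanish_of_ext_quotSMulTop_left {M N : ModuleCat.{u} R} {x : R}
    (hM : IsSMulRegular M x) (hN : x • 𝟙 N = 0) {i : ℕ}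
    (h : Subsingleton (Ext (ModuleCat.of R (QuotSMulTop x M)) N (i + 1))) :
    Subsingleton (Ext M N i) := by
  refine subsingleton_of_forall_eq 0 fun e => ?_
  obtain ⟨e', he'⟩ := Ext.contravariant_sequence_exact₁ hM.smulShortComplex_shortExact N e
    (n₁ := i + 1) (by lia) (h.elim _ _)
  have key (e' : Ext M N i) : (Ext.mk₀ (x • 𝟙 M)).comp e' (zero_add i) = 0 := by
    rw [Ext.mk₀_smul, Ext.smul_comp, Ext.mk₀_id_comp, Ext.smul_eq_comp_mk₀, hN, Ext.mk₀_zero,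
      Ext.comp_zero]
  exact he'.symm.trans (key e')

end RegularElement

/-! ### Finiteness of the finitistic dimension. -/

section FinitisticDimension

variable {R : Type u} [CommRing R]

/-- The map `F → Ext^i(X, F)` induced by a class in `Ext^i(X, R)` and `F ≃ Hom(R, F)`. -/
noncomputable def extOfElement {X : ModuleCat.{u} R} {i : ℕ} (α : Ext X (ModuleCat.of R R) i)
    (F : ModuleCat.{u} R) : F →ₗ[R] Ext X F i where
  toFun v := α.comp (Ext.mk₀ (ModuleCat.ofHom (LinearMap.toSpanSingleton R F v))) (add_zero i)
  map_add' v w := by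
    rw [LinearMap.toSpanSingleton_add, ModuleCat.ofHom_add, Ext.mk₀_add, Ext.comp_add]
  map_smul' r v := by
    have : ModuleCat.ofHom (LinearMap.toSpanSingleton R F (r • v)) =
        r • ModuleCat.ofHom (LinearMap.toSpanSingleton R F v) := by
      rw [LinearMap.toSpanSingleton_smul]
      rfl
    rw [this, Ext.mk₀_smul, Ext.comp_smul]
    rfl

theorem extOfElement_map {X : ModuleCat.{u} R} {i : ℕ} (α : Ext X (ModuleCat.of R R) i)
    {F G : ModuleCat.{u} R} (φ : F ⟶ G) (v : F) :
    (extOfElement α F v).comp (Ext.mk₀ φ) (add_zero i) = extOfElement α G (φ v) := by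
  have : ModuleCat.ofHom (LinearMap.toSpanSingleton R F v) ≫ φ =
      ModuleCat.ofHom (LinearMap.toSpanSingleton R G (φ v)) := by
    ext; simp
  simp only [extOfElement, LinearMap.coe_mk, AddHom.coe_mk]
  rw [Ext.comp_assoc (a₁₂ := i) (a₂₃ := 0) _ _ _ (by lia) (by lia) (by lia), Ext.mk₀_comp_mk₀, this]

variable [IsLocalRing R]

open IsLocalRing

variable (R) in
/-- The residue field as an object of the category of modules. -/
noncomputable abbrev residueModule : ModuleCat.{u} R := ModuleCat.of R (ResidueField R)

theorem smul_ext_residueModule (X : ModuleCat.{u} R) {i : ℕ} (e : Ext (residueModule R) X i)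
    {r : R} (hr : r ∈ maximalIdeal R) : r • e = 0 := by
  have h : r • 𝟙 (residueModule R) = 0 := by
    ext (v : ResidueField R)
    change r • v = 0
    rw [Algebra.smul_def, ResidueField.algebraMap_eq, (residue_eq_zero_iff r).2 hr, zero_mul]
  rw [← Ext.mk₀_id_comp e, ← Ext.smul_comp, ← Ext.mk₀_smul, h, Ext.mk₀_zero, Ext.zero_comp]

theorem extOfElement_eq_zero_of_mem {i : ℕ} (α : Ext (residueModule R) (ModuleCat.of R R) i)
    {F : ModuleCat.{u} R} {v : F} (hv : v ∈ maximalIdeal R • (⊤ : Submodule R F)) :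
    extOfElement α F v = 0 := by
  refine Submodule.smul_induction_on hv (fun r hr w _ => ?_) fun v w hv hw => ?_
  · rw [map_smul, smul_ext_residueModule _ _ hr]
  · rw [map_add, hv, hw, add_zero]

/-- A coordinate of `v` outside the maximal ideal is a unit, and it would kill `α`. Thus a nonzero
`α` detects `F/mF` inside `Ext^i(k, F)`. -/
theorem mem_smul_top_of_extOfElement_eq_zero {i : ℕ}
    {α : Ext (residueModule R) (ModuleCat.of R R) i} (hα : α ≠ 0) {F : ModuleCat.{u} R}
    [Module.Free R F] [Module.Finite R F] {v : F} (hv : extOfElement α F v = 0) :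
    v ∈ maximalIdeal R • (⊤ : Submodule R F) := by
  let b := Module.Free.chooseBasis R F
  rw [← b.sum_repr v]
  refine Submodule.sum_mem _ fun k _ => Submodule.smul_mem_smul ?_ trivial
  by_contra hk
  have h₁ : extOfElement α (ModuleCat.of R R) (b.repr v k) = 0 := by
    have := extOfElement_map α (ModuleCat.ofHom (b.coord k)) v
    rw [hv, Ext.zero_comp] at this
    exact this.symm
  have h₂ : extOfElement α (ModuleCat.of R R) (1 : R) = α := by
    have : ModuleCat.ofHom (LinearMap.toSpanSingleton R R 1) = 𝟙 (ModuleCat.of R R) := by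
      ext; simp
    simp only [extOfElement, LinearMap.coe_mk, AddHom.coe_mk]
    rw [this, Ext.comp_mk₀_id]
  have h₃ : extOfElement α (ModuleCat.of R R) (b.repr v k) = (b.repr v k) • α := by
    conv_rhs => rw [← h₂]
    rw [← map_smul, smul_eq_mul, mul_one]
  have hu : IsUnit (b.repr v k) := by simpa using hk
  exact hα (hu.smul_eq_zero.1 (h₃.symm.trans h₁))

theorem tmul_residueField_eq_zero_iff {M : Type*} [AddCommGroup M] [Module R M] (v : M) :
    (1 : ResidueField R) ⊗ₜ[R] v = 0 ↔ v ∈ maximalIdeal R • (⊤ : Submodule R M) := by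
  refine (TensorProduct.quotTensorEquivQuotSMul M (maximalIdeal R)).map_eq_zero_iff.symm.trans ?_
  have := TensorProduct.quotTensorEquivQuotSMul_mk_tmul (M := M) (maximalIdeal R) 1 v
  rw [one_smul] at this
  rw [← Submodule.Quotient.mk_eq_zero, ← this]
  rfl

theorem exists_tmul_residueField {M : Type*} [AddCommGroup M] [Module R M]
    (z : TensorProduct R (ResidueField R) M) : ∃ v : M, z = (1 : ResidueField R) ⊗ₜ[R] v := by
  induction z with
  | zero => exact ⟨0, by simp⟩
  | tmul a v =>
    obtain ⟨r, rfl⟩ := residue_surjective a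
    refine ⟨r • v, ?_⟩
    rw [← TensorProduct.smul_tmul, Algebra.smul_def, mul_one]
    rfl
  | add z w hz hw =>
    obtain ⟨v, rfl⟩ := hz
    obtain ⟨w, rfl⟩ := hw
    exact ⟨v + w, by rw [TensorProduct.tmul_add]⟩

/-- A finitely generated module of projective dimension at most one with `Ext^i(k, M) = 0` for all
`i < t`, where `t` is the depth of `R`, is projective. -/
theorem projective_of_hasProjectiveDimensionLE_one [IsNoetherianRing R] {t : ℕ}
    (ht : ¬ Subsingleton (Ext (residueModule R) (ModuleCat.of R R) t)) (M : ModuleCat.{u} R)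
    [Module.Finite R M] (hM : ∀ i < t, Subsingleton (Ext (residueModule R) M i))
    (hpd : HasProjectiveDimensionLE M 1) : Projective M := by
  obtain ⟨N, hN, hNM⟩ := exists_isSyzygy M
  have hN' : HasProjectiveDimensionLE N 0 := (hNM.hasProjectiveDimensionLE_succ_iff 0).1 hpd
  obtain ⟨S, hS, rfl, rfl, _, _⟩ := hNM
  rw [← projective_iff_hasProjectiveDimensionLE_zero, ← IsProjective.iff_projective] at hN'
  have : Module.Free R S.X₁ := Module.free_of_flat_of_isLocalRing
  rw [not_subsingleton_iff_nontrivial] at ht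
  obtain ⟨α, hα⟩ := exists_ne (0 : Ext (residueModule R) (ModuleCat.of R R) t)
  -- The map of free modules splits once it is injective modulo `m`; the class `α` tests this inside
  -- `Ext^t(k, -)`.
  have hinj : Function.Injective (S.f.hom.lTensor (ResidueField R)) := by
    rw [injective_iff_map_eq_zero]
    intro z hz
    obtain ⟨v, rfl⟩ := exists_tmul_residueField z
    rw [LinearMap.lTensor_tmul, tmul_residueField_eq_zero_iff] at hz
    rw [tmul_residueField_eq_zero_iff]
    refine mem_smul_top_of_extOfElement_eq_zero hα ?_
    have h₀ : (extOfElement α S.X₁ v).comp (Ext.mk₀ S.f) (add_zero t) = 0 :=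
      (extOfElement_map α S.f v).trans (extOfElement_eq_zero_of_mem α hz)
    -- For `t = 0` this is left exactness of Hom; otherwise the kernel comes from `Ext^(t-1)(k, M) =
    -- 0`.
    rcases t with _ | t
    · have := hS.mono_f
      exact (injective_iff_map_eq_zero _).1
        (Ext.postcomp_mk₀_injective_of_mono (residueModule R) S.f) _ h₀
    · obtain ⟨y, hy⟩ := Ext.covariant_sequence_exact₁ _ hS _ h₀ rfl
      rw [← hy, (hM t (by lia)).elim y 0, Ext.zero_comp]
  obtain ⟨l, hl⟩ := (split_injective_iff_lTensor_residueField_injective S.f.hom).2 hinj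
  have hsp : S.Splitting := ShortComplex.Splitting.ofExactOfRetraction S hS.exact
    (ModuleCat.ofHom l) (by ext v; exact LinearMap.congr_fun hl v) hS.epi_g
  exact (Retract.mk hsp.s S.g hsp.s_g).projective

/-- Each syzygy lowers the projective dimension by one and gains one degree of vanishing of `Ext(k,
-)`, until the case of dimension at most one applies. -/
theorem hasProjectiveDimensionLE_of_succ [IsNoetherianRing R] {t : ℕ}
    (ht : ¬ Subsingleton (Ext (residueModule R) (ModuleCat.of R R) t))
    (ht' : ∀ i < t, Subsingleton (Ext (residueModule R) (ModuleCat.of R R) i)) (j : ℕ) :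
    ∀ (M : ModuleCat.{u} R) [Module.Finite R M],
      (∀ i, i + j < t → Subsingleton (Ext (residueModule R) M i)) →
      HasProjectiveDimensionLE M (j + 1) → HasProjectiveDimensionLE M j := by
  induction j with
  | zero =>
    intro M _ hM hpd
    exact (projective_iff_hasProjectiveDimensionLE_zero M).1
      (projective_of_hasProjectiveDimensionLE_one ht M hM hpd)
  | succ j ih =>
    intro M _ hM hpd
    obtain ⟨N, _, h⟩ := exists_isSyzygy M
    rw [h.hasProjectiveDimensionLE_succ_iff] at hpd ⊢
    refine ih N (fun i hi => ?_) hpd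
    rcases i with _ | i
    · obtain ⟨S, hS, rfl, rfl, _, _⟩ := h
      have := hS.mono_f
      have := ext_free_vanish _ S.X₂ (ht' 0 (by lia))
      exact (Ext.postcomp_mk₀_injective_of_mono (residueModule R) S.f).subsingleton
    · exact h.ext_right _ rfl (ht' _ (by lia)) (hM i (by lia))

/-- Some `Ext^t(k, R)` is nonzero, by the Rees theorem and the finiteness of the dimension. -/
theorem exists_ext_residueModule_ne [IsNoetherianRing R] :
    ∃ t : ℕ, ¬ Subsingleton (Ext (residueModule R) (ModuleCat.of R R) t) := by
  by_contra! h
  obtain ⟨d, hd⟩ : ∃ d : ℕ, ringKrullDim R = d := by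
    lift ringKrullDim R to ℕ∞ using ringKrullDim_ne_bot with d hd
    have : d ≠ ⊤ := fun h => ringKrullDim_ne_top (R := R) (by rw [← hd, h]; rfl)
    lift d to ℕ using this
    exact ⟨d, rfl⟩
  have hsupp : Module.support R (residueModule R) =
      PrimeSpectrum.zeroLocus (maximalIdeal R : Set R) := by
    rw [Module.support_of_algebra, ResidueField.algebraMap_eq, ker_residue]
  -- Length `d + 1` is too long: each term of a regular sequence lowers the dimension by one.
  obtain ⟨rs, hlen, -, hreg⟩ := ModuleCat.exists_isRegular_of_exists_subsingleton_ext
    (maximalIdeal R) (d + 1) (ModuleCat.of R R)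
    (by simpa [lt_top_iff_ne_top] using Ideal.IsPrime.ne_top') (residueModule R) hsupp
    fun i _ => h i
  have hdim := ringKrullDim_add_length_eq_ringKrullDim_of_isRegular rs hreg
  have hne : Nontrivial (R ⧸ Ideal.ofList rs) := by
    refine Ideal.Quotient.nontrivial_iff.2 fun h => hreg.2 ?_
    rw [h, Ideal.smul_eq_mul, Ideal.top_mul]
  have h0 : (0 : WithBot ℕ∞) ≤ ringKrullDim (R ⧸ Ideal.ofList rs) :=
    ringKrullDim_nonneg_of_nontrivial
  have hle : ((d + 1 : ℕ) : WithBot ℕ∞) ≤ (d : ℕ) := by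
    rw [← hd, ← hdim, ← hlen]
    exact le_add_of_nonneg_left h0
  have : d + 1 ≤ d := by exact_mod_cast hle
  lia

/-- The finitistic dimension of a Noetherian local ring is finite. -/
theorem exists_finitistic_bound (R : Type u) [CommRing R] [IsLocalRing R] [IsNoetherianRing R] :
    ∃ t : ℕ, ∀ (M : ModuleCat.{u} R) [Module.Finite R M] (n : ℕ),
      HasProjectiveDimensionLE M n → HasProjectiveDimensionLE M t := by
  classical
  have hex := exists_ext_residueModule_ne (R := R)
  refine ⟨Nat.find hex, ?_⟩
  have key := hasProjectiveDimensionLE_of_succ (Nat.find_spec hex)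
    (fun i hi => not_not.1 (Nat.find_min hex hi)) (Nat.find hex)
  have aux (n : ℕ) : ∀ (M : ModuleCat.{u} R) [Module.Finite R M],
      HasProjectiveDimensionLE M (Nat.find hex + n) → HasProjectiveDimensionLE M (Nat.find hex) := by
    induction n with
    | zero => exact fun _ _ h => h
    | succ n ih =>
      intro M _ hM
      obtain ⟨N, _, h⟩ := exists_isSyzygy M
      -- For `j = t` the Ext condition is vacuous.
      refine key M (fun i hi => by lia) ?_
      rw [h.hasProjectiveDimensionLE_succ_iff]
      exact ih N ((h.hasProjectiveDimensionLE_succ_iff _).1 hM)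
  exact fun M _ n hM => aux n M (hasProjectiveDimensionLT_of_ge M (n + 1) _ (by lia))

end FinitisticDimension

/-! ### Extension degrees, and from SAC to a finite bound. -/

section ExtDegree

variable {R : Type u} [CommRing R]

theorem extDeg_le_iff (M : Type u) [AddCommGroup M] [Module R M] (k : ℕ) :
    extDeg R M ≤ k ↔ ∀ i : ℕ, k < i → ExtVanishes R M M i := by
  simp only [extDeg, iSup_le_iff, Nat.cast_le]
  exact forall_congr' fun i => ⟨fun h hi => by_contra fun hn => hi.not_ge (h hn),
    fun h hn => not_lt.1 fun hi => hn (h hi)⟩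

theorem extDeg_lt_top_iff (M : Type u) [AddCommGroup M] [Module R M] :
    extDeg R M < ⊤ ↔ ∃ k : ℕ, ∀ i : ℕ, k < i → ExtVanishes R M M i := by
  refine ⟨fun h => ?_, fun ⟨k, hk⟩ => ((extDeg_le_iff M k).2 hk).trans_lt (ENat.natCast_lt_top k)⟩
  lift extDeg R M to ℕ using h.ne with k hk
  exact ⟨k, (extDeg_le_iff M k).1 hk.ge⟩

theorem extVanishes_prod_self_iff (M : Type u) [AddCommGroup M] [Module R M] {i : ℕ} (hi : 0 < i) :
    ExtVanishes R (M × R) (M × R) i ↔ ExtVanishes R M M i ∧ ExtVanishes R M R i := by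
  have hR (X : ModuleCat.{u} R) : Subsingleton (Ext (ModuleCat.of R R) X i) := by
    obtain ⟨i, rfl⟩ := Nat.exists_eq_succ_of_ne_zero hi.ne'
    exact Ext.subsingleton_of_projective _ _ _
  simp only [ExtVanishes, ext_prod_left_iff, ext_prod_right_iff]
  have h₁ := hR (ModuleCat.of R M)
  have h₂ := hR (ModuleCat.of R R)
  tauto

theorem extVanishes_prod_free_iff (M F : Type u) [AddCommGroup M] [Module R M] [AddCommGroup F]
    [Module R F] [Module.Free R F] [Module.Finite R F] {i : ℕ} (hi : 0 < i) :
    ExtVanishes R (M × F) (M × F) i ∧ ExtVanishes R (M × F) R i ↔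
      ExtVanishes R M M i ∧ ExtVanishes R M R i := by
  have hF (X : ModuleCat.{u} R) : Subsingleton (Ext (ModuleCat.of R F) X i) := by
    obtain ⟨i, rfl⟩ := Nat.exists_eq_succ_of_ne_zero hi.ne'
    exact Ext.subsingleton_of_projective _ _ _
  simp only [ExtVanishes, ext_prod_left_iff, ext_prod_right_iff]
  have h₁ := hF (ModuleCat.of R M)
  have h₂ := hF (ModuleCat.of R R)
  have h₃ := hF (ModuleCat.of R F)
  have h₄ := ext_free_vanish (ModuleCat.of R M) (ModuleCat.of R F) (i := i)
  tauto

theorem rfed_lt_top_iff :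
    rfed R < ⊤ ↔ ∃ b : ℕ, ∀ (M : ModuleCat.{u} R), Module.Finite R M →
      extDeg R (M × R) < ⊤ → extDeg R (M × R) ≤ b := by
  constructor
  · intro h
    lift rfed R to ℕ using h.ne with b hb
    exact ⟨b, fun M hM hlt => hb ▸ le_sSup ⟨M, hM, rfl, hlt⟩⟩
  · rintro ⟨b, hb⟩
    refine lt_of_le_of_lt (sSup_le ?_) (ENat.natCast_lt_top b)
    rintro _ ⟨M, hM, rfl, hlt⟩
    exact hb M hM hlt

theorem rfedRank_le_rfed (n : ℕ) : rfedRank R n ≤ rfed R :=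
  sSup_le_sSup fun _ ⟨M, hM, _, hd⟩ => ⟨M, hM, hd⟩

/-- Under the symmetric Auslander condition, a finitely generated module `N` with `Ext^i(N, R) = 0`
for `i > 0` and `Ext^i(N, N) = 0` for large `i` is projective: apply the condition to the direct sum
of `N` and its first syzygy. -/
theorem SAC.projective [IsNoetherianRing R] (h : SAC R) (N : ModuleCat.{u} R) [Module.Finite R N]
    (hR : ∀ i, 0 < i → Subsingleton (Ext N (ModuleCat.of R R) i))
    (hN : ∃ k, ∀ i, k < i → Subsingleton (Ext N N i)) : Projective N := by
  obtain ⟨L, _, hL⟩ := exists_isSyzygy N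
  replace hN : ∀ i, 0 < i → Subsingleton (Ext N N i) := h N hR hN
  have hNL (i : ℕ) (hi : 1 < i) : Subsingleton (Ext N L i) := by
    obtain ⟨i, rfl⟩ := Nat.exists_eq_succ_of_ne_zero (by lia : i ≠ 0)
    exact hL.ext_right N rfl (hR _ (by lia)) (hN i (by lia))
  have hLX (X : ModuleCat.{u} R) (i : ℕ) (hi : 0 < i) (hX : Subsingleton (Ext N X (i + 1))) :
      Subsingleton (Ext L X i) := (hL.ext_left_iff X hi rfl).2 hX
  -- Among the four summands only `Ext^1(N, L)` is not yet known to vanish, whence the bound `1`.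
  have hs := h (N × L)
    (fun i hi => (ext_prod_left_iff _ N L i).2 ⟨hR i hi, hLX _ i hi (hR _ (by lia))⟩)
    ⟨1, fun i hi => (ext_prod_left_iff _ N L i).2
      ⟨(ext_prod_right_iff _ N L i).2 ⟨hN i (by lia), hNL i hi⟩,
        (ext_prod_right_iff _ N L i).2 ⟨hLX N i (by lia) (hN _ (by lia)),
          hLX L i (by lia) (hNL _ (by lia))⟩⟩⟩ 1 one_pos
  exact hL.projective_of_ext_one
    ((ext_prod_right_iff _ N L 1).1 ((ext_prod_left_iff _ N L 1).1 hs).1).2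

/-- The symmetric Auslander condition implies that a finitely generated module with
`Ext^i(M, R) = 0` for `i > n` and `Ext^i(M, M) = 0` for large `i` has projective dimension at most
`n`. -/
theorem SAC.hasProjectiveDimensionLE [IsNoetherianRing R] (h : SAC R) (n : ℕ) :
    ∀ (M : ModuleCat.{u} R) [Module.Finite R M],
      (∀ i, n < i → Subsingleton (Ext M (ModuleCat.of R R) i)) →
      (∃ k, ∀ i, k < i → Subsingleton (Ext M M i)) → HasProjectiveDimensionLE M n := by
  induction n with
  | zero =>
    intro M _ hR hM
    exact (projective_iff_hasProjectiveDimensionLE_zero M).1 (h.projective M hR hM)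
  | succ n ih =>
    rintro M _ hR ⟨k, hk⟩
    obtain ⟨N, _, hNM⟩ := exists_isSyzygy M
    refine (hNM.hasProjectiveDimensionLE_succ_iff n).2 (ih N (fun i hi => ?_)
      ⟨k + n + 1, fun i hi => ?_⟩)
    · exact (hNM.ext_left_iff _ (by lia) rfl).2 (hR _ (by lia))
    · exact (hNM.ext_left_iff _ (by lia) rfl).2
        (hNM.ext_right M rfl (hR _ (by lia)) (hk _ (by lia)))

theorem SAC.rfed_lt_top [IsLocalRing R] [IsNoetherianRing R] (h : SAC R) : rfed R < ⊤ := by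
  obtain ⟨t, ht⟩ := exists_finitistic_bound R
  refine rfed_lt_top_iff.2 ⟨t, fun M _ hM => ?_⟩
  obtain ⟨k, hk⟩ := (extDeg_lt_top_iff _).1 hM
  have hk' (i : ℕ) (hi : k < i) := (extVanishes_prod_self_iff M (by lia)).1 (hk i hi)
  have := ht M k (h.hasProjectiveDimensionLE k M (fun i hi => (hk' i hi).2)
    ⟨k, fun i hi => (hk' i hi).1⟩)
  refine (extDeg_le_iff _ t).2 fun i hi => (extVanishes_prod_self_iff M (by lia)).2
    ⟨?_, ?_⟩ <;> exact HasProjectiveDimensionLT.subsingleton _ (t + 1) i hi _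

end ExtDegree

/-! ### Constant rank of torsion plus free modules. -/

section ConstantRank

variable {R : Type u} [CommRing R]

theorem subsingleton_fractionRing_tensor {x : R} (hx : x ∈ nonZeroDivisors R) (T : Type u)
    [AddCommGroup T] [Module R T] (hT : ∀ v : T, x • v = 0) :
    Subsingleton (TensorProduct R (FractionRing R) T) := by
  refine subsingleton_of_forall_eq 0 fun z => ?_
  induction z with
  | zero => rfl
  | tmul a v =>
    have hu := IsLocalization.map_units (FractionRing R) ⟨x, hx⟩
    obtain ⟨c, rfl⟩ : ∃ c, a = x • c := by
      obtain ⟨u, hu⟩ := hu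
      exact ⟨↑u⁻¹ * a, by rw [Algebra.smul_def, ← mul_assoc]; simp [← hu]⟩
    rw [TensorProduct.smul_tmul, hT, TensorProduct.tmul_zero]
  | add z w hz hw => rw [hz, hw, add_zero]

theorem hasConstantRank_prod_of_smul_eq_zero {x : R} (hx : x ∈ nonZeroDivisors R) (T : Type u)
    [AddCommGroup T] [Module R T] (hT : ∀ v : T, x • v = 0) (n : ℕ) :
    HasConstantRank R (T × (Fin n → R)) n := by
  have := subsingleton_fractionRing_tensor hx T hT
  let : Unique (TensorProduct R (FractionRing R) T) := uniqueOfSubsingleton 0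
  exact ⟨(TensorProduct.prodRight R (FractionRing R) (FractionRing R) T (Fin n → R)).trans
    ((LinearEquiv.uniqueProd (R := FractionRing R)).trans
      (TensorProduct.piScalarRight R (FractionRing R) (FractionRing R) (Fin n)))⟩

end ConstantRank

/-! ### From a bound in constant rank to SAC. -/

section RankToSAC

variable {R : Type u} [CommRing R]

/-- A `j`-th syzygy `Y` of a finitely generated module `M`, described by its effect on the
vanishing of `Ext`. -/
theorem exists_iterated_syzygy [IsNoetherianRing R] (M : ModuleCat.{u} R) [Module.Finite R M]
    {x : R} (hR : IsSMulRegular R x) (hM : IsSMulRegular M x) (j : ℕ) :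
    ∃ Y : ModuleCat.{u} R, Module.Finite R Y ∧ IsSMulRegular Y x ∧
      (∀ (X : ModuleCat.{u} R) (i : ℕ), 0 < i → Subsingleton (Ext M X (i + j)) →
        Subsingleton (Ext Y X i)) ∧
      (∀ X : ModuleCat.{u} R, (∀ i, 0 < i → Subsingleton (Ext X (ModuleCat.of R R) i)) →
        ∀ i, 0 < i → (Subsingleton (Ext X Y (i + j)) ↔ Subsingleton (Ext X M i))) := by
  induction j with
  | zero => exact ⟨M, ‹_›, hM, fun _ _ _ h => h, fun _ _ _ _ => Iff.rfl⟩
  | succ j ih =>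
    obtain ⟨Y, _, -, hl, hr⟩ := ih
    obtain ⟨Z, _, hZ⟩ := exists_isSyzygy Y
    refine ⟨Z, ‹_›, hZ.isSMulRegular hR, fun X i hi h => ?_, fun X hX i hi => ?_⟩
    · exact (hZ.ext_left_iff X hi rfl).2 (hl X _ (by lia) (by convert h using 2; lia))
    · rw [← hr X hX i hi]
      exact ⟨hZ.ext_of_ext_right X rfl (hX _ (by lia)), hZ.ext_right X rfl (hX _ (by lia))⟩

theorem ext_quotSMulTop_vanish {M N : ModuleCat.{u} R} {x : R} (hM : IsSMulRegular M x)
    (hN : IsSMulRegular N x) {k : ℕ} (h : ∀ i, k < i → Subsingleton (Ext M N i)) (i : ℕ)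
    (hi : k + 1 < i) :
    Subsingleton (Ext (ModuleCat.of R (QuotSMulTop x M)) (ModuleCat.of R (QuotSMulTop x N)) i) := by
  have h' (i : ℕ) (hi : k < i) : Subsingleton (Ext M (ModuleCat.of R (QuotSMulTop x N)) i) :=
    ext_covariant_vanish₃ hN.smulShortComplex_shortExact M rfl (h i hi) (h _ (by lia))
  obtain ⟨i, rfl⟩ := Nat.exists_eq_succ_of_ne_zero (by lia : i ≠ 0)
  exact ext_contravariant_vanish₃ hM.smulShortComplex_shortExact _ rfl (h' i (by lia))
    (h' _ (by lia))

theorem ext_quotSMulTop_left_vanish {M N : ModuleCat.{u} R} {x : R} (hM : IsSMulRegular M x)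
    {k : ℕ} (h : ∀ i, k < i → Subsingleton (Ext M N i)) (i : ℕ) (hi : k + 1 < i) :
    Subsingleton (Ext (ModuleCat.of R (QuotSMulTop x M)) N i) := by
  obtain ⟨i, rfl⟩ := Nat.exists_eq_succ_of_ne_zero (by lia : i ≠ 0)
  exact ext_contravariant_vanish₃ hM.smulShortComplex_shortExact _ rfl (h i (by lia)) (h _ (by lia))

theorem smul_quotSMulTop_eq_zero (M : Type u) [AddCommGroup M] [Module R M] (x : R)
    (v : QuotSMulTop x M) : x • v = 0 :=
  Module.mem_annihilator.1 (QuotSMulTop.mem_annihilator M x) v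

/-- The modules killed by a regular element `x` become modules of constant rank `n` after adding a
free module of rank `n`, so the bound given by `rfedRank` applies to them. -/
theorem exists_bound_of_rfedRank_lt_top {x : R} (hR : IsSMulRegular R x) {n : ℕ}
    (hn : rfedRank R n < ⊤) :
    ∃ b : ℕ, ∀ (T : ModuleCat.{u} R) [Module.Finite R T], (∀ v : T, x • v = 0) →
      (∃ k, ∀ i, k < i →
        Subsingleton (Ext T (ModuleCat.of R R) i) ∧ Subsingleton (Ext T T i)) →
      ∀ i, b < i → Subsingleton (Ext T T i) := by
  obtain ⟨b, hb⟩ := ENat.ne_top_iff_exists.1 hn.ne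
  refine ⟨b, fun T _ hT ⟨k, hk⟩ i hi => ?_⟩
  have hx : x ∈ nonZeroDivisors R :=
    mem_nonZeroDivisors_iff_left.2 fun _ hy => hR.right_eq_zero_of_smul hy
  have hrank := hasConstantRank_prod_of_smul_eq_zero hx T hT n
  have hlt : extDeg R ((T × (Fin n → R)) × R) < ⊤ :=
    (extDeg_lt_top_iff _).2 ⟨k, fun i hi =>
      (extVanishes_prod_self_iff _ (by lia)).2
        ((extVanishes_prod_free_iff T _ (by lia)).2 ⟨(hk i hi).2, (hk i hi).1⟩)⟩
  have hle : extDeg R ((T × (Fin n → R)) × R) ≤ b := by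
    rw [hb]
    exact le_sSup ⟨ModuleCat.of R (T × (Fin n → R)),
      inferInstanceAs (Module.Finite R (T × (Fin n → R))), hrank, rfl, hlt⟩
  have hv := (extVanishes_prod_self_iff (R := R) (T × (Fin n → R)) (by lia : 0 < i)).1
    ((extDeg_le_iff _ b).1 hle i hi)
  exact ((extVanishes_prod_free_iff T _ (by lia)).1 hv).1

theorem exists_bound_ext_of_rfedRank_lt_top [IsLocalRing R] [IsNoetherianRing R] {x : R}
    (hx : x ∈ IsLocalRing.maximalIdeal R) (hR : IsSMulRegular R x) {n : ℕ}
    (hn : rfedRank R n < ⊤) :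
    ∃ b : ℕ, ∀ (M N : ModuleCat.{u} R) [Module.Finite R M] [Module.Finite R N],
      IsSMulRegular M x → IsSMulRegular N x →
      (∀ i, 0 < i → Subsingleton (Ext M (ModuleCat.of R R) i)) →
      (∀ i, 0 < i → Subsingleton (Ext N (ModuleCat.of R R) i)) →
      (∃ k, ∀ i, k < i → Subsingleton (Ext M M i) ∧ Subsingleton (Ext M N i) ∧
        Subsingleton (Ext N M i) ∧ Subsingleton (Ext N N i)) →
      ∀ i, b ≤ i → Subsingleton (Ext M N i) := by
  obtain ⟨b, hb⟩ := exists_bound_of_rfedRank_lt_top hR hn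
  refine ⟨b, ?_⟩
  rintro M N _ _ hM hN hMR hNR ⟨k, hk⟩ i hi
  -- The degree is `i + 1` because `Ext^i(M, N/xN)` embeds in `Ext^(i+1)(M/xM, N/xN)`; this turns `b
  -- < i + 1` into `b ≤ i`.
  have hT := hb (ModuleCat.of R (QuotSMulTop x M × QuotSMulTop x N))
    (fun v => Prod.ext (smul_quotSMulTop_eq_zero M x v.1) (smul_quotSMulTop_eq_zero N x v.2))
    ⟨k + 1, fun i hi => ⟨(ext_prod_left_iff _ _ _ i).2
      ⟨ext_quotSMulTop_left_vanish hM hMR i (by lia),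
        ext_quotSMulTop_left_vanish hN hNR i (by lia)⟩,
      (ext_prod_left_iff _ _ _ i).2
      ⟨(ext_prod_right_iff _ _ _ i).2
        ⟨ext_quotSMulTop_vanish hM hM (fun i hi => (hk i hi).1) i hi,
          ext_quotSMulTop_vanish hM hN (fun i hi => (hk i hi).2.1) i hi⟩,
        (ext_prod_right_iff _ _ _ i).2
        ⟨ext_quotSMulTop_vanish hN hM (fun i hi => (hk i hi).2.2.1) i hi,
          ext_quotSMulTop_vanish hN hN (fun i hi => (hk i hi).2.2.2) i hi⟩⟩⟩⟩ (i + 1) (by lia)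
  have hMN := ((ext_prod_right_iff _ _ _ _).1 ((ext_prod_left_iff _ _ _ _).1 hT).1).2
  refine ext_vanish_of_ext_quotSMulTop_right hx hN (ext_vanish_of_ext_quotSMulTop_left hM ?_ hMN)
  exact ModuleCat.hom_ext (LinearMap.ext fun v => smul_quotSMulTop_eq_zero N x v)

theorem sac_of_rfedRank_lt_top [IsLocalRing R] [IsNoetherianRing R] {x : R}
    (hx : x ∈ IsLocalRing.maximalIdeal R) (hR : IsSMulRegular R x) {n : ℕ}
    (hn : rfedRank R n < ⊤) : SAC R := by
  obtain ⟨b, hb⟩ := exists_bound_ext_of_rfedRank_lt_top hx hR hn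
  intro M _ _ _ hMR ⟨k, hk⟩ e he
  obtain ⟨N, _, hN⟩ := exists_isSyzygy (ModuleCat.of R M)
  have hNreg := hN.isSMulRegular hR
  have hNR (i : ℕ) (hi : 0 < i) : Subsingleton (Ext N (ModuleCat.of R R) i) :=
    (hN.ext_left_iff _ hi rfl).2 (hMR _ (by lia))
  have hNN (i : ℕ) (hi : 0 < i) :
      Subsingleton (Ext N N i) ↔ Subsingleton (Ext (ModuleCat.of R M) (ModuleCat.of R M) i) := by
    rw [hN.ext_left_iff _ hi rfl]
    exact ⟨hN.ext_of_ext_right _ rfl (hMR i hi), hN.ext_right _ rfl (hMR _ (by lia))⟩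
  obtain ⟨Y, _, hYreg, hYl, hYr⟩ := exists_iterated_syzygy N hR hNreg b
  have hYR (i : ℕ) (hi : 0 < i) : Subsingleton (Ext Y (ModuleCat.of R R) i) :=
    hYl _ i hi (hNR _ (by lia))
  have hNN' (i : ℕ) (hi : k < i) : Subsingleton (Ext N N i) := (hNN i (by lia)).2 (hk i hi)
  have hNY (i : ℕ) (hi : k + b < i) : Subsingleton (Ext N Y i) := by
    obtain ⟨i, rfl⟩ : ∃ i', i = i' + b := ⟨i - b, by lia⟩
    exact (hYr N hNR i (by lia)).2 (hNN' i (by lia))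
  -- The bound applies in degree `e + b`, where `Ext(N, Y)` vanishes exactly when `Ext^e(N, N)`
  -- does.
  refine (hNN e he).1 ((hYr N hNR e he).1 (hb N Y hNreg hYreg hNR hYR ⟨k + b, fun i hi => ?_⟩ _
    (by lia)))
  exact ⟨hNN' i (by lia), hNY i hi, hYl _ i (by lia) (hNN' _ (by lia)),
    hYl _ i (by lia) (hNY _ (by lia))⟩

theorem exists_isSMulRegular_of_depth_pos [IsLocalRing R] (h : 0 < depth R) :
    ∃ x ∈ IsLocalRing.maximalIdeal R, IsSMulRegular R x := by
  obtain ⟨_, ⟨rs, hmem, hreg, rfl⟩, hpos⟩ := lt_sSup_iff.1 h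
  rcases rs with _ | ⟨x, rs⟩
  · simp at hpos
  · exact ⟨x, hmem x (by simp), ((RingTheory.Sequence.isRegular_cons_iff R x rs).1 hreg).1⟩

end RankToSAC

end Rfed

theorem theorem6p5 (R : Type u) [CommRing R] [IsLocalRing R] [IsNoetherianRing R]
    (hdepth : 0 < Rfed.depth R) :
    List.TFAE [Rfed.SAC R, Rfed.rfed R < ⊤, ∃ n : ℕ, Rfed.rfedRank R n < ⊤] := by
  obtain ⟨x, hx, hreg⟩ := Rfed.exists_isSMulRegular_of_depth_pos hdepth
  tfae_have 1 → 2 := fun h => h.rfed_lt_top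
  tfae_have 2 → 3 := fun h => ⟨0, (Rfed.rfedRank_le_rfed 0).trans_lt h⟩
  tfae_have 3 → 1 := fun ⟨_, hn⟩ => Rfed.sac_of_rfedRank_lt_top hx hreg hn
  tfae_finish
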